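/- Let $G$ be a second countable, locally compact Hausdorff group with left Haar measure $dg$, and let $P\subset G$ be a closed subsemigroup containing the identity such that $G=PP^{-1}$ and $\mathrm{Int}(P)$ is dense in $P$. Let $\mathcal H$ be a complex Hilbert space and let $V:P\to B(\mathcal H)$ be an isometric representation with commuting range projections, that is: $a\mapsto V_a$ and $a\mapsto V_a^*$ are strongly continuous, each $V_a$ is an isometry, $V_aV_b=V_{ba}$ for $a,b\in P$, and the projections $V_aV_a^*$ $(a\in P)$ commute with each other. For $g=ab^{-1}\in G$ with $a,b\in P$ put $W_g=V_b^*V_a$ (this does not depend on the choice of $a,b$) and $E_g=W_gW_g^*$; for $f\in L^1(G)$ put $E_f=\int f(g)E_g\,dg$ (strong integral). Let $\mathcal A\subset B(\mathcal H)$ be the $C^*$-algebra generated by $\{E_f: f\in L^1(G)\}$, which is commutative and unital, and let $\Omega$ be its spectrum, i.e. the space of characters (nonzero multiplicative linear functionals) of $\mathcal A$ with the weak-$*$ topology. The semigroup $P$ acts on $\Omega$ from the right by $(\chi\cdot a)(T)=\chi(V_a^*TV_a)$ for $\chi\in\Omega$, $a\in P$, $T\in\mathcal A$. The support $A_\chi\subset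 G$ of $\chi\in\Omega$ is defined as follows: $g\notin A_\chi$ if and only if there is an open set $U\ni g$ such that $\chi(E_f)=0$ for all $f\in C_c(G)$ with $\mathrm{supp}(f)\subset U$. Let $$\Omega_u=\{A\subset G \text{ closed}: P^{-1}\subset A,\ P^{-1}A\subset A\},$$ with the subspace topology of the Vietoris (Fell) topology on the closed subsets of $G$, whose subbasis is formed by the sets $\{A: A\cap U\neq\emptyset\}$, $U$ open, and $\{A: A\cap K=\emptyset\}$, $K$ compact; $P$ acts on $\Omega_u$ from the right by $A\cdot a=Aa=\{xa:x\in A\}$. Then $A_\chi\in\Omega_u$ for every $\chi\in\Omega$, and the map $\Omega\to\Omega_u$, $\chi\mapsto A_\chi$, is injective, continuous and $P$-equivariant, i.e. $A_{\chi\cdot a}=A_\chi a$ for $\chi\in\Omega$, $a\in P$. Consequently the action of $P$ on $\Omega$ is injective: for every $a\in P$ the map $\chi\mapsto\chi\cdot a$ is injective. Moreover, for every $\chi\in\Omega$ and $f\in L^1(G)$, $$\chi\Big(\int f(g)E_g\,dg\Big)=\int f(g)1_{A_\chi}(g)\,dg .$$ -/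

import Mathlib

open MeasureTheory Topology
open scoped InnerProduct

/-- Standing assumptions on the semigroup: `P` is a closed subsemigroup of `G` containing the
identity, `G = P P⁻¹`, and the interior of `P` is dense in `P`. -/
class ClosedOreSemigroup {G : Type*} [Group G] [TopologicalSpace G] (P : Submonoid G) : Prop where
  isClosed : IsClosed (P : Set G)
  eq_mul_inv : ∀ g : G, ∃ a b : P, g = (a : G) * (b : G)⁻¹
  subset_closure_interior : (P : Set G) ⊆ closure (interior (P : Set G))

/-- An isometric representation of `P` on a Hilbert space `H` with commuting range projections. -/
structure CommIsomRep {G : Type*} [Group G] [TopologicalSpace G] (P : Submonoid G)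
    (H : Type*) [NormedAddCommGroup H] [InnerProductSpace ℂ H] [CompleteSpace H] where
  /-- the isometries `V_a` -/
  V : P → (H →L[ℂ] H)
  continuous_V : ∀ ξ : H, Continuous fun a => V a ξ
  continuous_V_adjoint : ∀ ξ : H, Continuous fun a => ((V a)†) ξ
  isometry_V : ∀ a, Isometry (V a)
  V_mul_V : ∀ a b, V a * V b = V (b * a)
  commute_range : ∀ a b, Commute (V a * (V a)†) (V b * (V b)†)

namespace CommIsomRep

noncomputable section

set_option linter.unusedSectionVars false

variable {G : Type*} [Group G] [TopologicalSpace G] {P : Submonoid G}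
  {H : Type*} [NormedAddCommGroup H] [InnerProductSpace ℂ H] [CompleteSpace H]

section Basic

variable (R : CommIsomRep P H)

lemma adjoint_mul_self (a : P) : (R.V a)† * R.V a = 1 := by
  have h := (ContinuousLinearMap.norm_map_iff_adjoint_comp_self (R.V a)).1
    (fun x => (R.isometry_V a).norm_map_of_map_zero (map_zero _) x)
  exact h

lemma adjoint_mul (S T : H →L[ℂ] H) : (S * T)† = T† * S† :=
  ContinuousLinearMap.adjoint_comp S T

lemma norm_V_le (a : P) : ‖R.V a‖ ≤ 1 :=
  ContinuousLinearMap.opNorm_le_bound _ zero_le_one fun x => by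
    rw [one_mul]
    exact ((R.isometry_V a).norm_map_of_map_zero (map_zero _) x).le

/-- `α_a(T) = V_a^* T V_a` on `B(H)`. -/
def conj (a : P) : (H →L[ℂ] H) →L[ℂ] (H →L[ℂ] H) :=
  (ContinuousLinearMap.mul ℂ (H →L[ℂ] H) ((R.V a)†)).comp
    ((ContinuousLinearMap.mul ℂ (H →L[ℂ] H)).flip (R.V a))

lemma conj_apply (a : P) (T : H →L[ℂ] H) : R.conj a T = (R.V a)† * (T * R.V a) := rfl

lemma adjoint_range (a : P) : star (R.V a * (R.V a)†) = R.V a * (R.V a)† := by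
  rw [ContinuousLinearMap.star_eq_adjoint, adjoint_mul, ContinuousLinearMap.adjoint_adjoint]

lemma conj_mul (a : P) {S T : H →L[ℂ] H} (hT : Commute (R.V a * (R.V a)†) T) :
    R.conj a (S * T) = R.conj a S * R.conj a T := by
  simp only [conj_apply]
  have h := R.adjoint_mul_self a
  calc (R.V a)† * (S * T * R.V a) = (R.V a)† * (S * T * (R.V a * ((R.V a)† * R.V a))) := by
        rw [h, mul_one]
    _ = (R.V a)† * S * (T * (R.V a * (R.V a)†)) * R.V a := by simp only [mul_assoc]
    _ = (R.V a)† * S * ((R.V a * (R.V a)†) * T) * R.V a := by rw [hT.eq]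
    _ = _ := by simp only [mul_assoc]

variable [ClosedOreSemigroup P]

lemma interior_nonempty : (interior (P : Set G)).Nonempty := by
  rw [← closure_nonempty_iff]
  exact ⟨1, ClosedOreSemigroup.subset_closure_interior (P := P) P.one_mem⟩

/-- `W_g = V_b^* V_a` where `g = a b⁻¹` with `a, b ∈ P`; independent of the choice of `a, b`
by `W_eq`. -/
def W (g : G) : H →L[ℂ] H :=
  (R.V (ClosedOreSemigroup.eq_mul_inv (P := P) g).choose_spec.choose)† *
    R.V (ClosedOreSemigroup.eq_mul_inv (P := P) g).choose

lemma W_aux (a b c d : P) (h : (a : G) * (b : G)⁻¹ = (c : G) * (d : G)⁻¹) :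
    (R.V b)† * R.V a = (R.V d)† * R.V c := by
  obtain ⟨s, t, hst⟩ := ClosedOreSemigroup.eq_mul_inv (P := P) ((a : G)⁻¹ * c)
  have hac : a * s = c * t := by
    apply Subtype.ext
    push_cast
    have : (c : G) = a * (s * (t : G)⁻¹) := by rw [← hst]; group
    rw [this]; group
  have hbd : b * s = d * t := by
    apply Subtype.ext
    push_cast
    have h2 : (a : G)⁻¹ * c = (b : G)⁻¹ * d := by
      calc (a : G)⁻¹ * c = (a : G)⁻¹ * (c * (d : G)⁻¹) * d := by group
        _ = (b : G)⁻¹ * d := by rw [← h]; group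
    rw [h2] at hst
    have : (d : G) = b * (s * (t : G)⁻¹) := by rw [← hst]; group
    rw [this]; group
  have key : ∀ x y s : P, (R.V y)† * R.V x = (R.V (y * s))† * R.V (x * s) := by
    intro x y s
    rw [← R.V_mul_V, ← R.V_mul_V, adjoint_mul, mul_assoc, ← mul_assoc _ (R.V s),
      adjoint_mul_self, one_mul]
  rw [key a b s, key c d t, hac, hbd]

lemma W_eq (a b : P) : R.W ((a : G) * (b : G)⁻¹) = (R.V b)† * R.V a :=
  R.W_aux _ _ _ _
    (ClosedOreSemigroup.eq_mul_inv (P := P) ((a : G) * (b : G)⁻¹)).choose_spec.choose_spec.symm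

/-- `E_g = W_g W_g^*`. -/
def E (g : G) : H →L[ℂ] H := R.W g * (R.W g)†

lemma E_eq (a b : P) :
    R.E ((a : G) * (b : G)⁻¹) = (R.V b)† * (R.V a * (R.V a)†) * R.V b := by
  simp only [E, W_eq, adjoint_mul, ContinuousLinearMap.adjoint_adjoint, mul_assoc]

lemma norm_W_le (g : G) : ‖R.W g‖ ≤ 1 := by
  refine (norm_mul_le _ _).trans (mul_le_one₀ ?_ (norm_nonneg _) (R.norm_V_le _))
  rw [LinearIsometryEquiv.norm_map]
  exact R.norm_V_le _

lemma norm_E_le (g : G) : ‖R.E g‖ ≤ 1 := by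
  refine (norm_mul_le _ _).trans (mul_le_one₀ (R.norm_W_le g) (norm_nonneg _) ?_)
  rw [LinearIsometryEquiv.norm_map]
  exact R.norm_W_le g

lemma norm_E_apply_le (g : G) (ξ : H) : ‖R.E g ξ‖ ≤ ‖ξ‖ :=
  ((R.E g).le_opNorm ξ).trans (mul_le_of_le_one_left (norm_nonneg _) (R.norm_E_le g))

lemma adjoint_W (g : G) : (R.W g)† = R.W g⁻¹ := by
  obtain ⟨a, b, rfl⟩ := ClosedOreSemigroup.eq_mul_inv (P := P) g
  have : ((a : G) * (b : G)⁻¹)⁻¹ = (b : G) * (a : G)⁻¹ := by group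
  rw [this, W_eq, W_eq, adjoint_mul, ContinuousLinearMap.adjoint_adjoint]

lemma V_conj_E (a : P) (g : G) : (R.V a)† * R.E g * R.V a = R.E (g * (a : G)⁻¹) := by
  obtain ⟨c, b, rfl⟩ := ClosedOreSemigroup.eq_mul_inv (P := P) g
  have : (c : G) * (b : G)⁻¹ * (a : G)⁻¹ = (c : G) * ((a * b : P) : G)⁻¹ := by
    push_cast; group
  rw [this, E_eq, E_eq, ← R.V_mul_V, adjoint_mul]
  simp only [mul_assoc]

lemma commute_range_E (a : P) (g : G) : Commute (R.V a * (R.V a)†) (R.E g) := by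
  obtain ⟨c, b, rfl⟩ := ClosedOreSemigroup.eq_mul_inv (P := P) g
  have h1 : R.V a * (R.V a)† = (R.V b)† * (R.V (a * b) * (R.V (a * b))†) * R.V b := by
    rw [← R.V_mul_V, adjoint_mul]
    have := R.adjoint_mul_self b
    calc R.V a * (R.V a)† = ((R.V b)† * R.V b) * (R.V a * (R.V a)†) * ((R.V b)† * R.V b) := by
          rw [this, one_mul, mul_one]
      _ = _ := by simp only [mul_assoc]
  rw [h1, E_eq]
  set X := R.V (a * b) * (R.V (a * b))†
  set Y := R.V c * (R.V c)†
  have hXY : Commute X Y := R.commute_range _ _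
  have hXB : Commute X (R.V b * (R.V b)†) := R.commute_range _ _
  have hYB : Commute Y (R.V b * (R.V b)†) := R.commute_range _ _
  have e : X * (R.V b * (R.V b)†) * Y = Y * (R.V b * (R.V b)†) * X := by
    rw [hXB.eq, mul_assoc, hXY.eq, ← mul_assoc, hYB.eq]
  calc (R.V b)† * X * R.V b * ((R.V b)† * Y * R.V b)
      = (R.V b)† * (X * (R.V b * (R.V b)†) * Y) * R.V b := by simp only [mul_assoc]
    _ = (R.V b)† * (Y * (R.V b * (R.V b)†) * X) * R.V b := by rw [e]
    _ = (R.V b)† * Y * R.V b * ((R.V b)† * X * R.V b) := by simp only [mul_assoc]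

lemma E_inv (a : P) : R.E (a : G)⁻¹ = 1 := by
  have h := R.E_eq 1 a
  have h1 : R.V 1 * (R.V 1)† = 1 := by
    have h2 : R.V 1 * R.V 1 = R.V 1 := by rw [R.V_mul_V, one_mul]
    have h3 : R.V 1 = 1 := by
      calc R.V 1 = ((R.V 1)† * R.V 1) * R.V 1 := by rw [adjoint_mul_self, one_mul]
        _ = 1 := by rw [mul_assoc, h2, adjoint_mul_self]
    have h4 := R.adjoint_mul_self 1
    rw [h3, mul_one] at h4
    rw [h3, h4, one_mul]
  rw [h1, mul_one, adjoint_mul_self] at h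
  simpa using h

end Basic

section Continuity

variable [IsTopologicalGroup G] [ClosedOreSemigroup P] (R : CommIsomRep P H)

lemma continuous_W (ξ : H) : Continuous fun g => R.W g ξ := by
  rw [continuous_iff_continuousAt]
  intro g₀
  obtain ⟨a, b, hg⟩ := ClosedOreSemigroup.eq_mul_inv (P := P) g₀
  obtain ⟨s, hs⟩ := interior_nonempty (P := P)
  have hsP : s ∈ P := interior_subset hs
  set b' : P := b * ⟨s, hsP⟩
  have hmem : g₀ * (b' : G) ∈ interior (P : Set G) := by
    have h1 : g₀ * (b' : G) = a * s := by simp [b', hg]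
    rw [h1]
    have h2 : (fun x => (a : G) * x) '' interior (P : Set G) ⊆ interior (P : Set G) := by
      apply interior_maximal
      · rintro _ ⟨x, hx, rfl⟩
        exact P.mul_mem a.2 (interior_subset hx)
      · exact (isOpenMap_mul_left (a : G)) _ isOpen_interior
    exact h2 ⟨s, hs, rfl⟩
  have hU : IsOpen {g : G | g * (b' : G) ∈ interior (P : Set G)} :=
    isOpen_interior.preimage (continuous_mul_const _)
  set U : Set G := {g : G | g * (b' : G) ∈ interior (P : Set G)}
  have hUP : ∀ g : U, (g : G) * (b' : G) ∈ P := fun g => interior_subset g.2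
  have hcont : ContinuousOn (fun g => R.W g ξ) U := by
    rw [continuousOn_iff_continuous_domRestrict]
    have h3 : U.domRestrict (fun g => R.W g ξ) =
        fun g : U => ((R.V b')†) (R.V ⟨(g : G) * b', hUP g⟩ ξ) := by
      funext g
      have h4 := R.W_eq ⟨(g : G) * b', hUP g⟩ b'
      simp only [mul_inv_cancel_right] at h4
      simp only [Set.domRestrict_apply, h4, mul_apply_eq_comp]
    rw [h3]
    refine ((R.V b')†).continuous.comp ((R.continuous_V ξ).comp ?_)
    exact Continuous.subtype_mk (continuous_subtype_val.mul continuous_const) _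
  exact hcont.continuousAt (hU.mem_nhds hmem)

lemma continuous_E (ξ : H) : Continuous fun g => R.E g ξ := by
  rw [continuous_iff_continuousAt]
  intro g₀
  have hadj : Continuous fun g => ((R.W g)†) ξ := by
    simp only [adjoint_W]
    exact (R.continuous_W ξ).comp continuous_inv
  have h1 : Filter.Tendsto (fun g => ‖((R.W g)†) ξ - ((R.W g₀)†) ξ‖ +
      ‖R.W g (((R.W g₀)†) ξ) - R.W g₀ (((R.W g₀)†) ξ)‖) (𝓝 g₀) (𝓝 0) := by
    have h2 : Continuous fun g => ‖((R.W g)†) ξ - ((R.W g₀)†) ξ‖ +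
        ‖R.W g (((R.W g₀)†) ξ) - R.W g₀ (((R.W g₀)†) ξ)‖ :=
      ((hadj.sub continuous_const).norm).add
        (((R.continuous_W _).sub continuous_const).norm)
    simpa using h2.tendsto g₀
  rw [ContinuousAt, tendsto_iff_norm_sub_tendsto_zero]
  refine squeeze_zero (fun _ => norm_nonneg _) (fun g => ?_) h1
  have h3 : R.E g ξ - R.E g₀ ξ = R.W g (((R.W g)†) ξ - ((R.W g₀)†) ξ) +
      (R.W g (((R.W g₀)†) ξ) - R.W g₀ (((R.W g₀)†) ξ)) := by
    simp only [E, mul_apply_eq_comp, map_sub]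
    abel
  rw [h3]
  refine (norm_add_le _ _).trans (add_le_add ?_ le_rfl)
  exact ((R.W g).le_opNorm _).trans (mul_le_of_le_one_left (norm_nonneg _) (R.norm_W_le g))

end Continuity

section Algebra

variable [IsTopologicalGroup G] [LocallyCompactSpace G] [SecondCountableTopology G]
  [MeasurableSpace G] [BorelSpace G] [ClosedOreSemigroup P] (R : CommIsomRep P H)
  (μ : Measure G)

lemma integrable_smul_E {f : G → ℂ} (hf : Integrable f μ) (ξ : H) :
    Integrable (fun g => f g • R.E g ξ) μ := by
  refine (hf.norm.mul_const ‖ξ‖).mono' ?_ (.of_forall fun g => ?_)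
  · exact hf.aestronglyMeasurable.smul (R.continuous_E ξ).aestronglyMeasurable
  · rw [norm_smul]
    exact mul_le_mul_of_nonneg_left (R.norm_E_apply_le g ξ) (norm_nonneg _)

/-- For `f ∈ L¹(G)`, the operator `E_f = ∫ f(g) E_g dg` (integral in the strong sense). -/
def intE (f : G → ℂ) (hf : Integrable f μ) : H →L[ℂ] H :=
  LinearMap.mkContinuous
    { toFun := fun ξ => ∫ g, f g • R.E g ξ ∂μ
      map_add' := fun ξ η => by
        rw [← integral_add (R.integrable_smul_E μ hf ξ) (R.integrable_smul_E μ hf η)]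
        simp only [map_add, smul_add]
      map_smul' := fun c ξ => by
        simp only [map_smul, RingHom.id_apply]
        rw [← integral_smul]
        exact integral_congr_ae (.of_forall fun g => smul_comm _ _ _) }
    (∫ g, ‖f g‖ ∂μ)
    (fun ξ => by
      change ‖∫ g, f g • R.E g ξ ∂μ‖ ≤ _
      rw [← integral_mul_const]
      refine norm_integral_le_of_norm_le (hf.norm.mul_const ‖ξ‖) (.of_forall fun g => ?_)
      rw [norm_smul]
      exact mul_le_mul_of_nonneg_left (R.norm_E_apply_le g ξ) (norm_nonneg _))

lemma intE_apply {f : G → ℂ} (hf : Integrable f μ) (ξ : H) :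
    R.intE μ f hf ξ = ∫ g, f g • R.E g ξ ∂μ := rfl

/-- The (norm closed) C*-algebra `𝒜` generated by the operators `E_f`, `f ∈ L¹(G)`. -/
def algA : NonUnitalStarSubalgebra ℂ (H →L[ℂ] H) :=
  (NonUnitalStarAlgebra.adjoin ℂ
    {T : H →L[ℂ] H | ∃ (f : G → ℂ) (hf : Integrable f μ), T = R.intE μ f hf}).topologicalClosure

lemma intE_mem {f : G → ℂ} (hf : Integrable f μ) : R.intE μ f hf ∈ R.algA μ :=
  NonUnitalStarSubalgebra.le_topologicalClosure _
    (NonUnitalStarAlgebra.subset_adjoin ℂ _ ⟨f, hf, rfl⟩)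

/-- `Ω`, the spectrum of `𝒜`: the nonzero multiplicative functionals on `𝒜` with the weak-*
topology. -/
abbrev Ω : Set (WeakDual ℂ (R.algA μ)) := WeakDual.characterSpace ℂ (R.algA μ)

/-- `E_f` as an element of `𝒜`. -/
def elemE (f : G → ℂ) (hf : Integrable f μ) : R.algA μ := ⟨R.intE μ f hf, R.intE_mem μ hf⟩

/-- The support `A_χ` of a character `χ`: `g ∉ A_χ` iff there is an open `U ∋ g` such that
`χ(∫ f(g) E_g dg) = 0` for all `f ∈ C_c(G)` with `supp f ⊆ U`. -/
def supp [IsFiniteMeasureOnCompacts μ] (χ : R.Ω μ) : Set G :=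
  {g | ∃ U : Set G, IsOpen U ∧ g ∈ U ∧
    ∀ (f : G → ℂ) (hc : Continuous f) (hs : HasCompactSupport f), tsupport f ⊆ U →
      χ (R.elemE μ f (hc.integrable_of_hasCompactSupport hs)) = 0}ᶜ

lemma conj_intE_mem [μ.IsHaarMeasure] (a : P) {f : G → ℂ} (hf : Integrable f μ) :
    R.conj a (R.intE μ f hf) ∈ R.algA μ := by
  have hmeas : Measurable fun g : G => g * (a : G)⁻¹ := measurable_mul_const _
  set ν : Measure G := μ.map fun g => g * (a : G)⁻¹ with hν
  obtain ⟨c, hc⟩ : ∃ c : NNReal, ν = c • μ := ⟨_, Measure.isMulLeftInvariant_eq_smul ν μ⟩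
  have hfν : Integrable (fun g => f (g * a)) ν := by
    have h := (integrable_map_equiv (μ := μ) (MeasurableEquiv.mulRight (a : G)⁻¹)
      fun g => f (g * a)).2 (by simpa [Function.comp_def] using hf)
    exact h
  have hf' : Integrable (fun g => (c : ℂ) * f (g * a)) μ := by
    rcases eq_or_ne c 0 with h0 | h0
    · simp [h0]
    · rw [hc] at hfν
      exact ((integrable_smul_measure (c := (c : ENNReal)) (by simpa using h0)
        ENNReal.coe_ne_top).1 hfν).const_mul _
  have key : R.conj a (R.intE μ f hf) = R.intE μ _ hf' := by
    ext ξ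
    have h1 : R.conj a (R.intE μ f hf) ξ = ((R.V a)†) (R.intE μ f hf (R.V a ξ)) := rfl
    have h2 : ∀ g, ((R.V a)†) (f g • R.E g (R.V a ξ)) = f g • R.E (g * (a : G)⁻¹) ξ := by
      intro g
      rw [← V_conj_E, map_smul]; rfl
    rw [h1, intE_apply, intE_apply,
      ← ContinuousLinearMap.integral_comp_comm _ (R.integrable_smul_E μ hf _)]
    simp only [h2]
    calc ∫ g, f g • R.E (g * (a : G)⁻¹) ξ ∂μ = ∫ g, f (g * a) • R.E g ξ ∂ν := by
          have h := integral_map_equiv (μ := μ) (MeasurableEquiv.mulRight (a : G)⁻¹)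
            fun g => f (g * a) • R.E g ξ
          refine Eq.trans ?_ h.symm
          simp
      _ = ∫ g, ((c : ℂ) * f (g * a)) • R.E g ξ ∂μ := by
          rw [hc, integral_smul_nnreal_measure]
          simp only [mul_smul]
          rw [integral_smul]
          rfl
  rw [key]
  exact R.intE_mem μ hf'

lemma commute_range_intE (a : P) {f : G → ℂ} (hf : Integrable f μ) :
    Commute (R.V a * (R.V a)†) (R.intE μ f hf) := by
  ext ξ
  simp only [mul_apply_eq_comp, intE_apply]
  have h : ∀ g, f g • R.E g (R.V a (((R.V a)†) ξ)) = (R.V a * (R.V a)†) (f g • R.E g ξ) := by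
    intro g
    rw [map_smul]
    congr 1
    exact (congrArg (fun T : H →L[ℂ] H => T ξ) (R.commute_range_E a g).eq).symm
  simp only [h]
  rw [ContinuousLinearMap.integral_comp_comm _ (R.integrable_smul_E μ hf _)]
  rfl

lemma conj_aux [μ.IsHaarMeasure] (a : P) {T : H →L[ℂ] H} (hT : T ∈ R.algA μ) :
    Commute (R.V a * (R.V a)†) T ∧ R.conj a T ∈ R.algA μ := by
  have hclosed : IsClosed ((R.algA μ : NonUnitalStarSubalgebra ℂ (H →L[ℂ] H)) :
      Set (H →L[ℂ] H)) := NonUnitalStarSubalgebra.isClosed_topologicalClosure _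
  have hC : IsClosed {T : H →L[ℂ] H | Commute (R.V a * (R.V a)†) T ∧ R.conj a T ∈ R.algA μ} := by
    refine IsClosed.inter (isClosed_eq ?_ ?_) (hclosed.preimage (R.conj a).continuous)
    · exact continuous_const.mul continuous_id
    · exact continuous_id.mul continuous_const
  refine closure_minimal ?_ hC hT
  intro T hT
  induction hT using NonUnitalStarAlgebra.adjoin_induction with
  | mem x hx =>
    obtain ⟨f, hf, rfl⟩ := hx
    exact ⟨R.commute_range_intE μ a hf, R.conj_intE_mem μ a hf⟩
  | add x y _ _ hx hy =>
    exact ⟨hx.1.add_right hy.1, by rw [map_add]; exact add_mem hx.2 hy.2⟩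
  | zero => exact ⟨Commute.zero_right _, by rw [map_zero]; exact zero_mem _⟩
  | mul x y _ _ hx hy =>
    exact ⟨hx.1.mul_right hy.1, by rw [R.conj_mul a hy.1]; exact mul_mem hx.2 hy.2⟩
  | smul r x _ hx =>
    exact ⟨hx.1.smul_right r, by rw [map_smul]; exact SMulMemClass.smul_mem r hx.2⟩
  | star x _ hx =>
    refine ⟨?_, ?_⟩
    · have := hx.1.star_star
      rwa [adjoint_range] at this
    · have h : R.conj a (star x) = star (R.conj a x) := by
        simp only [conj_apply, star_mul, ContinuousLinearMap.star_eq_adjoint,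
          ContinuousLinearMap.adjoint_adjoint, mul_assoc]
      rw [h]
      exact star_mem hx.2

lemma one_mem [μ.IsHaarMeasure] : (1 : H →L[ℂ] H) ∈ R.algA μ := by
  obtain ⟨s, hs⟩ := interior_nonempty (P := P)
  have hU : IsOpen (interior (P : Set G))⁻¹ := isOpen_interior.inv
  obtain ⟨K, hK, hsK, hKU⟩ := exists_compact_subset hU (Set.inv_mem_inv.2 hs)
  have hm : MeasurableSet (interior K) := isOpen_interior.measurableSet
  have hfin : μ (interior K) ≠ ⊤ :=
    ((measure_mono interior_subset).trans_lt hK.measure_lt_top).ne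
  have hpos : μ (interior K) ≠ 0 := (isOpen_interior.measure_pos μ ⟨_, hsK⟩).ne'
  have hr : (μ.real (interior K) : ℂ) ≠ 0 := by
    exact_mod_cast (ENNReal.toReal_pos hpos hfin).ne'
  have hf : Integrable ((interior K).indicator fun _ => ((μ.real (interior K) : ℂ))⁻¹) μ :=
    (integrable_indicator_iff hm).2 (integrableOn_const hfin)
  have key : R.intE μ _ hf = 1 := by
    ext ξ
    rw [intE_apply]
    have h : ∀ g, (interior K).indicator (fun _ => ((μ.real (interior K) : ℂ))⁻¹) g • R.E g ξ =
        (interior K).indicator (fun _ => ((μ.real (interior K) : ℂ))⁻¹ • ξ) g := by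
      intro g
      by_cases hg : g ∈ interior K
      · rw [Set.indicator_of_mem hg, Set.indicator_of_mem hg]
        have h1 : g⁻¹ ∈ P := interior_subset (hKU (interior_subset hg))
        have h2 := R.E_inv ⟨g⁻¹, h1⟩
        simp only [inv_inv] at h2
        rw [h2]; rfl
      · rw [Set.indicator_of_notMem hg, Set.indicator_of_notMem hg, zero_smul]
    simp only [h]
    rw [integral_indicator hm, setIntegral_const, smul_comm, ← Complex.coe_smul, smul_smul,
      inv_mul_cancel₀ hr, one_smul]
    rfl
  rw [← key]
  exact R.intE_mem μ hf

/-- `α_a : 𝒜 → 𝒜`, `α_a(T) = V_a^* T V_a`. -/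
def alpha [μ.IsHaarMeasure] (a : P) : R.algA μ →L[ℂ] R.algA μ where
  toFun T := ⟨R.conj a T, (R.conj_aux μ a T.2).2⟩
  map_add' S T := Subtype.ext (map_add (R.conj a) S.1 T.1)
  map_smul' c T := Subtype.ext (map_smul (R.conj a) c T.1)
  cont := Continuous.subtype_mk ((R.conj a).continuous.comp continuous_subtype_val) _

/-- The right action of `P` on `Ω`: `χ · a = χ ∘ α_a`. -/
def act [μ.IsHaarMeasure] (χ : R.Ω μ) (a : P) : R.Ω μ :=
  ⟨(WeakDual.CharacterSpace.toCLM χ).comp (R.alpha μ a), by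
    have happ : ∀ T, (show WeakDual ℂ (R.algA μ) from
        (WeakDual.CharacterSpace.toCLM χ).comp (R.alpha μ a)) T = χ (R.alpha μ a T) :=
      fun _ => rfl
    refine ⟨fun h0 => ?_, fun S T => ?_⟩
    · have h1 : χ (R.alpha μ a ⟨1, R.one_mem μ⟩) = 0 := by
        rw [← happ]
        exact congrArg (fun φ : WeakDual ℂ (R.algA μ) => φ ⟨1, R.one_mem μ⟩) h0
      have h2 : R.alpha μ a ⟨1, R.one_mem μ⟩ = ⟨1, R.one_mem μ⟩ := by
        apply Subtype.ext
        change (R.V a)† * (1 * R.V a) = 1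
        rw [one_mul, adjoint_mul_self]
      rw [h2] at h1
      refine χ.2.1 (ContinuousLinearMap.ext fun T => ?_)
      change χ T = 0
      have h3 : T = T * ⟨1, R.one_mem μ⟩ := Subtype.ext (mul_one _).symm
      rw [h3, map_mul, h1, mul_zero]
    · have h1 : R.alpha μ a (S * T) = R.alpha μ a S * R.alpha μ a T :=
        Subtype.ext (R.conj_mul a (R.conj_aux μ a T.2).1)
      exact (congrArg χ h1).trans (map_mul χ _ _)⟩

lemma act_apply [μ.IsHaarMeasure] (χ : R.Ω μ) (a : P) (T : R.algA μ) :
    R.act μ χ a T = χ (R.alpha μ a T) := rfl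

lemma act_one [μ.IsHaarMeasure] (χ : R.Ω μ) : R.act μ χ 1 = χ := by
  refine WeakDual.CharacterSpace.ext fun T => ?_
  rw [act_apply]
  refine congrArg χ (Subtype.ext ?_)
  change (R.V 1)† * ((T : H →L[ℂ] H) * R.V 1) = T
  have h : R.V 1 = 1 := by
    calc R.V 1 = ((R.V 1)† * R.V 1) * R.V 1 := by rw [adjoint_mul_self, one_mul]
      _ = 1 := by rw [mul_assoc, R.V_mul_V, one_mul, adjoint_mul_self]
  have h4 := R.adjoint_mul_self 1
  rw [h, mul_one] at h4
  rw [h, h4, mul_one, one_mul]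

lemma act_act [μ.IsHaarMeasure] (χ : R.Ω μ) (a b : P) :
    R.act μ (R.act μ χ a) b = R.act μ χ (a * b) := by
  refine WeakDual.CharacterSpace.ext fun T => ?_
  simp only [act_apply]
  refine congrArg χ (Subtype.ext ?_)
  change (R.V a)† * (((R.V b)† * ((T : H →L[ℂ] H) * R.V b)) * R.V a) =
    (R.V (a * b))† * ((T : H →L[ℂ] H) * R.V (a * b))
  rw [← R.V_mul_V, adjoint_mul]
  simp only [mul_assoc]

end Algebra

end

end CommIsomRep

/-- The topology on the space of closed subsets of `X` called the Vietoris topology in the theory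
of groupoids (also known as the Fell topology): a subbasis is given by
`{A | A ∩ U ≠ ∅}` for `U` open and `{A | A ∩ K = ∅}` for `K` compact. If `X` is locally compact,
Hausdorff and second countable, it is compact and metrizable, and `A_n → A` in it iff
`liminf A_n = limsup A_n = A`. -/
@[reducible] def closedsTopology (X : Type*) [TopologicalSpace X] :
    TopologicalSpace (TopologicalSpace.Closeds X) :=
  TopologicalSpace.generateFrom
    ({s | ∃ U : Set X, IsOpen U ∧ s = {A : TopologicalSpace.Closeds X | ((A : Set X) ∩ U).Nonempty}} ∪
      {s | ∃ K : Set X, IsCompact K ∧ s = {A : TopologicalSpace.Closeds X | (A : Set X) ∩ K = ∅}})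

/-- `Ω_u`: the closed subsets `A` of `G` with `P⁻¹ ⊆ A` and `P⁻¹ A ⊆ A`. -/
structure OmegaU {G : Type*} [Group G] [TopologicalSpace G] (P : Submonoid G) where
  carrier : TopologicalSpace.Closeds G
  inv_mem : ∀ a ∈ P, a⁻¹ ∈ carrier
  inv_mul_mem : ∀ a ∈ P, ∀ x ∈ carrier, a⁻¹ * x ∈ carrier

namespace OmegaU

variable {G : Type*} [Group G] [TopologicalSpace G] {P : Submonoid G}

instance : TopologicalSpace (OmegaU P) :=
  TopologicalSpace.induced OmegaU.carrier (closedsTopology G)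

/-- The right action of `P` on `Ω_u`: `A a = {x a | x ∈ A}`. -/
def act [IsTopologicalGroup G] (A : OmegaU P) (a : P) : OmegaU P where
  carrier := ⟨(fun x => x * (a : G)) '' A.carrier,
    (isClosedMap_mul_right (a : G)) _ A.carrier.isClosed⟩
  inv_mem b hb := ⟨((a : G) * b)⁻¹, A.inv_mem _ (P.mul_mem a.2 hb), by group⟩
  inv_mul_mem b hb := by
    rintro _ ⟨x, hx, rfl⟩
    exact ⟨b⁻¹ * x, A.inv_mul_mem b hb x hx, by simp [mul_assoc]⟩

end OmegaU

/-! The engine is an order on the projections. Call x below y if `y * x⁻¹ ∈ P`; then `W y = W x *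
V_c` with c = yx⁻¹, so E_x E_y = E_y (`E_mul_E_of_mem`). If f₁ and f₂ live on X and Y, and every
point of X is below every point of Y, it follows that E_{f₁} E_{f₂} = (∫ f₁) E_{f₂}. Hence a
character that does not kill E_{f₂} must send E_{f₁} to ∫ f₁ (`apply_elemE_of_dominating`).

This dichotomy yields everything about the support A of χ. Points below A belong to A. Near interior
points of A, χ is integration; near points outside A, it vanishes, even on merely integrable
functions. The remaining set A \ Int A is null: if it had positive measure, Steinhaus' theorem would
provide x, y in it with xy⁻¹ ∈ Int(P), and this forces y ∈ Int A. A bounded functional on L¹ that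
vanishes locally off a null set is zero, so χ(E_f) = ∫ 1_A f (`apply_elemE_eq_integral_indicator`).

Injectivity follows because the values on the E_f determine a character (`ext_elemE`). Continuity
comes from testing against suitable f, again using the order. Equivariance holds because V_a^* E_f
V_a is a nonzero multiple of the operator of a right translate of f (`exists_conj_intE_eq_smul`). -/

section Preliminaries

/-! ### Local vanishing of functionals on integrable functions, and test functions. -/

/-- A bounded additive functional on integrable functions which vanishes locally off a null set
is zero. -/
lemma eq_zero_of_locally_eq_zero {X : Type*} [TopologicalSpace X] [SecondCountableTopology X]
    [Nonempty X] [MeasurableSpace X] [BorelSpace X] {μ : Measure X}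
    (D : ∀ f : X → ℂ, Integrable f μ → ℂ) (C : ℝ)
    (hadd : ∀ f g hf hg hfg, D (fun x => f x + g x) hfg = D f hf + D g hg)
    (hbound : ∀ f hf, ‖D f hf‖ ≤ C * ∫ x, ‖f x‖ ∂μ)
    {N : Set X} (hN : μ N = 0)
    (hloc : ∀ x ∉ N, ∃ U : Set X, IsOpen U ∧ x ∈ U ∧
      ∀ f hf, (∀ y ∉ U, f y = 0) → D f hf = 0)
    (f : X → ℂ) (hf : Integrable f μ) : D f hf = 0 := by
  have hloc' : ∀ x, ∃ U : Set X, IsOpen U ∧ (x ∉ N → x ∈ U) ∧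
      ∀ f hf, (∀ y ∉ U, f y = 0) → D f hf = 0 := by
    intro x
    by_cases hx : x ∈ N
    · refine ⟨∅, isOpen_empty, fun h => absurd hx h, fun f hf h => ?_⟩
      have h1 := hbound f hf
      simpa [h] using h1
    · obtain ⟨U, h1, h2, h3⟩ := hloc x hx
      exact ⟨U, h1, fun _ => h2, h3⟩
  choose U hUo hUm hUD using hloc'
  -- Lindelöf: countably many of the U cover the complement of N. Since the hypothesis concerns
  -- arbitrary integrable functions, indicators can cut f into pieces and no partition of unity is
  -- needed.
  obtain ⟨T, hTc, hT⟩ := TopologicalSpace.isOpen_iUnion_countable U hUo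
  obtain ⟨e, he⟩ := Set.countable_iff_exists_subset_range.1 hTc
  set S : ℕ → Set X := fun n => ⋃ k ∈ Finset.range n, U (e k)
  have hSo : ∀ n, IsOpen (S n) := fun n => isOpen_biUnion fun k _ => hUo _
  have hS : ∀ n f hf, (∀ y ∉ S n, f y = 0) → D f hf = 0 := by
    intro n
    induction n with
    | zero =>
      intro f hf h
      have h0 : ∀ y, f y = 0 := fun y => h y (by simp [S])
      simpa [h0] using hbound f hf
    | succ n ih =>
      intro f hf h
      have hm := (hUo (e n)).measurableSet
      have h1 := hadd _ _ (hf.indicator hm) (hf.indicator hm.compl)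
        (by simpa only [Set.indicator_self_add_compl_apply] using hf)
      have h2 : (fun x => (U (e n)).indicator f x + (U (e n))ᶜ.indicator f x) = f :=
        funext fun x => Set.indicator_self_add_compl_apply _ _ _
      simp only [h2] at h1
      rw [h1, hUD (e n) _ _ (fun y hy => Set.indicator_of_notMem hy _), ih, add_zero]
      intro y hy
      by_cases hyU : y ∈ U (e n)
      · exact Set.indicator_of_notMem (Set.notMem_compl_iff.2 hyU) _
      · rw [Set.indicator_of_mem hyU]
        refine h y fun hyS => ?_
        simp only [S, Set.mem_iUnion, Finset.mem_range, exists_prop] at hy hyS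
        obtain ⟨k, hk, hyk⟩ := hyS
        rcases Nat.lt_succ_iff_lt_or_eq.1 hk with hk | rfl
        · exact hy ⟨k, hk, hyk⟩
        · exact hyU hyk
  have hle : ∀ n, ‖D f hf‖ ≤ C * ∫ x in (S n)ᶜ, ‖f x‖ ∂μ := by
    intro n
    have hm := (hSo n).measurableSet
    have h1 := hadd _ _ (hf.indicator hm) (hf.indicator hm.compl)
      (by simpa only [Set.indicator_self_add_compl_apply] using hf)
    have h2 : (fun x => (S n).indicator f x + (S n)ᶜ.indicator f x) = f :=
      funext fun x => Set.indicator_self_add_compl_apply _ _ _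
    simp only [h2] at h1
    rw [h1, hS n _ _ (fun y hy => Set.indicator_of_notMem hy _), zero_add]
    refine (hbound _ _).trans_eq ?_
    simp only [norm_indicator_eq_indicator_norm]
    rw [integral_indicator hm.compl]
  have hmono : Monotone S := fun m n hmn => Set.biUnion_subset_biUnion_left fun k hk =>
    Finset.mem_range.2 ((Finset.mem_range.1 hk).trans_le hmn)
  have hinter : ⋂ n, (S n)ᶜ ⊆ N := by
    intro x hx
    by_contra hxN
    have h1 : x ∈ ⋃ i, U i := Set.mem_iUnion.2 ⟨x, hUm x hxN⟩
    rw [← hT] at h1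
    simp only [Set.mem_iUnion, exists_prop] at h1
    obtain ⟨i, hi, hxi⟩ := h1
    obtain ⟨k, rfl⟩ := he hi
    refine Set.mem_iInter.1 hx (k + 1) ?_
    simp only [S, Set.mem_iUnion, Finset.mem_range, exists_prop]
    exact ⟨k, Nat.lt_succ_self k, hxi⟩
  -- The part of f not covered by the first n sets has L¹ norm tending to its integral over a subset
  -- of N, which is zero.
  have hlim := tendsto_setIntegral_of_antitone (μ := μ) (f := fun x => ‖f x‖)
    (s := fun n => (S n)ᶜ) (fun n => (hSo n).measurableSet.compl)
    (fun m n hmn => Set.compl_subset_compl.2 (hmono hmn)) ⟨0, hf.norm.integrableOn⟩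
  rw [setIntegral_measure_zero _ (measure_mono_null hinter hN)] at hlim
  have h0 := ge_of_tendsto' (hlim.const_mul C) hle
  rw [mul_zero] at h0
  exact norm_le_zero_iff.1 h0

/-- Such an f tells apart the two local behaviours of a character: vanishing and integration. -/
lemma exists_continuous_tsupport_subset_integral_ne_zero {X : Type*} [TopologicalSpace X]
    [R1Space X] [LocallyCompactSpace X] [MeasurableSpace X] [BorelSpace X] (μ : Measure X)
    [IsFiniteMeasureOnCompacts μ] [μ.IsOpenPosMeasure] {U : Set X} (hU : IsOpen U)
    (hne : U.Nonempty) :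
    ∃ f : X → ℂ, Continuous f ∧ HasCompactSupport f ∧ tsupport f ⊆ U ∧ ∫ x, f x ∂μ ≠ 0 := by
  obtain ⟨x, hx⟩ := hne
  obtain ⟨f, hf1, hf2, hf3, hf4⟩ := exists_continuousMap_one_of_isCompact_subset_isOpen
    (isCompact_singleton (x := x)) hU (Set.singleton_subset_iff.2 hx)
  have hts : tsupport (fun y => (f y : ℂ)) ⊆ tsupport f :=
    closure_mono fun y hy => by
      simpa using hy
  refine ⟨fun y => (f y : ℂ), Complex.continuous_ofReal.comp f.continuous,
    hf2.of_isClosed_subset (isClosed_tsupport _) hts, hts.trans hf3, ?_⟩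
  rw [integral_complex_ofReal]
  refine Complex.ofReal_ne_zero.2 (ne_of_gt ?_)
  refine f.continuous.integral_pos_of_hasCompactSupport_nonneg_nonzero (x := x) hf2
    (fun y => (hf4 y).1) ?_
  rw [hf1 (Set.mem_singleton x)]
  exact one_ne_zero

lemma integrable_star {X : Type*} [MeasurableSpace X] {μ : Measure X} {f : X → ℂ}
    (hf : Integrable f μ) : Integrable (fun x => star (f x)) μ :=
  (Complex.conjCLE : ℂ →L[ℝ] ℂ).integrable_comp hf

end Preliminaries

/-! ### Topology of the semigroup order, and the Steinhaus argument. -/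

namespace ClosedOreSemigroup

variable {G : Type*} [Group G] [TopologicalSpace G] {P : Submonoid G}

lemma exists_open_mul_inv_mem [IsTopologicalGroup G] {x y : G} (h : y * x⁻¹ ∈ interior (P : Set G)) :
    ∃ X Y : Set G, IsOpen X ∧ IsOpen Y ∧ x ∈ X ∧ y ∈ Y ∧
      ∀ x' ∈ X, ∀ y' ∈ Y, y' * x'⁻¹ ∈ P := by
  have hc : Continuous fun p : G × G => p.2 * p.1⁻¹ := by fun_prop
  obtain ⟨X, Y, hX, hY, hx, hy, hXY⟩ :=
    isOpen_prod_iff.1 (isOpen_interior.preimage hc) x y h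
  exact ⟨X, Y, hX, hY, hx, hy, fun x' hx' y' hy' =>
    interior_subset (hXY (Set.mk_mem_prod hx' hy'))⟩

variable [ClosedOreSemigroup P]

lemma exists_mem_interior {U : Set G} (hU : U ∈ 𝓝 (1 : G)) : ∃ s ∈ interior (P : Set G), s ∈ U := by
  have h := subset_closure_interior (P := P) P.one_mem
  obtain ⟨s, h1, h2⟩ := mem_closure_iff_nhds.1 h U hU
  exact ⟨s, h2, h1⟩

variable [IsTopologicalGroup G]

lemma exists_mem_interior_mul {U : Set G} (hU : IsOpen U) {y : G} (hy : y ∈ U) :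
    ∃ s ∈ interior (P : Set G), s * y ∈ U := by
  have hc : Continuous fun s : G => s * y := by fun_prop
  exact exists_mem_interior (U := {s : G | s * y ∈ U})
    (hc.continuousAt.preimage_mem_nhds (hU.mem_nhds (by simpa using hy)))

lemma exists_mem_interior_inv_mul {U : Set G} (hU : IsOpen U) {y : G} (hy : y ∈ U) :
    ∃ s ∈ interior (P : Set G), s⁻¹ * y ∈ U := by
  have hc : Continuous fun s : G => s⁻¹ * y := by fun_prop
  exact exists_mem_interior (U := {s : G | s⁻¹ * y ∈ U})
    (hc.continuousAt.preimage_mem_nhds (hU.mem_nhds (by simpa using hy)))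

/-- Every point has neighbourhoods `Y`, dominated by a nonempty open subset of a given
neighbourhood `U`. -/
lemma exists_open_dominating (P : Submonoid G) [ClosedOreSemigroup P] {U : Set G} (hU : IsOpen U)
    {y : G} (hy : y ∈ U) :
    ∃ X Y : Set G, IsOpen X ∧ X.Nonempty ∧ X ⊆ U ∧ IsOpen Y ∧ y ∈ Y ∧
      ∀ x' ∈ X, ∀ y' ∈ Y, y' * x'⁻¹ ∈ P := by
  obtain ⟨s, hs, hsU⟩ := exists_mem_interior_inv_mul (P := P) hU hy
  obtain ⟨X, Y, hX, hY, hx, hy', hXY⟩ := exists_open_mul_inv_mem (P := P) (x := s⁻¹ * y) (y := y)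
    (by simpa using hs)
  exact ⟨X ∩ U, Y, hX.inter hU, ⟨_, hx, hsU⟩, Set.inter_subset_right, hY, hy',
    fun x' hx' => hXY x' hx'.1⟩

/-- By Steinhaus' theorem, the frontier of a closed set stable under `P⁻¹` is null. -/
lemma measure_diff_interior [LocallyCompactSpace G] [SecondCountableTopology G] [T2Space G]
    [MeasurableSpace G] [BorelSpace G] (μ : Measure G) [μ.IsHaarMeasure]
    {A : Set G} (hA : IsClosed A) (hPA : ∀ a ∈ P, ∀ x ∈ A, a⁻¹ * x ∈ A) :
    μ (A \ interior A) = 0 := by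
  by_contra hne
  have hn := Measure.div_mem_nhds_one_of_haar_pos μ (A \ interior A)
    (hA.measurableSet.diff isOpen_interior.measurableSet) (pos_iff_ne_zero.2 hne)
  obtain ⟨s, hs, x, hx, y, hy, hxy⟩ := exists_mem_interior (P := P) hn
  have hc : Continuous fun z : G => x * z⁻¹ := by fun_prop
  -- The open set of z with xz⁻¹ ∈ Int(P) lies in A, because z = (xz⁻¹)⁻¹x, and it contains y since
  -- xy⁻¹ = s.
  refine hy.2 (interior_maximal (t := (fun z : G => x * z⁻¹) ⁻¹' interior (P : Set G)) ?_
    (isOpen_interior.preimage hc) ?_)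
  · intro z hz
    simpa using hPA _ (interior_subset hz) x hx.1
  · rw [Set.mem_preimage, ← div_eq_mul_inv]
    exact (show x / y = s from hxy) ▸ hs

end ClosedOreSemigroup

/-! ### The order on the projections E_g. -/

namespace CommIsomRep

section Domination

variable {G : Type*} [Group G] [TopologicalSpace G] {P : Submonoid G}
  {H : Type*} [NormedAddCommGroup H] [InnerProductSpace ℂ H] [CompleteSpace H]
  [ClosedOreSemigroup P] (R : CommIsomRep P H)

lemma star_E (g : G) : star (R.E g) = R.E g := by
  rw [ContinuousLinearMap.star_eq_adjoint, E, adjoint_mul, ContinuousLinearMap.adjoint_adjoint]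

/-- This says that `W g` is a partial isometry. Commuting range projections let V_b V_b^* move past
V_a V_a^*, after which both are absorbed by the isometry relations. -/
lemma E_mul_W (g : G) : R.E g * R.W g = R.W g := by
  obtain ⟨a, b, rfl⟩ := ClosedOreSemigroup.eq_mul_inv (P := P) g
  rw [E_eq, W_eq]
  calc (R.V b)† * (R.V a * (R.V a)†) * R.V b * ((R.V b)† * R.V a)
      = (R.V b)† * ((R.V a * (R.V a)†) * (R.V b * (R.V b)†)) * R.V a := by simp only [mul_assoc]
    _ = ((R.V b)† * R.V b) * (R.V b)† * R.V a * ((R.V a)† * R.V a) := by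
      rw [(R.commute_range a b).eq]; simp only [mul_assoc]
    _ = (R.V b)† * R.V a := by rw [adjoint_mul_self, adjoint_mul_self, one_mul, mul_one]

lemma W_eq_mul_V {x y : G} (h : y * x⁻¹ ∈ P) : R.W y = R.W x * R.V ⟨y * x⁻¹, h⟩ := by
  obtain ⟨a, b, rfl⟩ := ClosedOreSemigroup.eq_mul_inv (P := P) x
  set c : P := ⟨_, h⟩ with hc
  have hy : y = ((c * a : P) : G) * (b : G)⁻¹ := by
    simp [hc, mul_assoc]
  rw [hy, W_eq, W_eq, ← R.V_mul_V, mul_assoc]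

lemma E_mul_E_of_mem {x y : G} (h : y * x⁻¹ ∈ P) : R.E x * R.E y = R.E y := by
  rw [E, E, ← E, W_eq_mul_V R h, ← mul_assoc, ← mul_assoc, E_mul_W]

end Domination

/-! ### The operators E_f and the values of characters on them. -/

section Character

variable {G : Type*} [Group G] [TopologicalSpace G] [IsTopologicalGroup G]
  [LocallyCompactSpace G] [SecondCountableTopology G] [MeasurableSpace G] [BorelSpace G]
  {P : Submonoid G} [ClosedOreSemigroup P]
  {H : Type*} [NormedAddCommGroup H] [InnerProductSpace ℂ H] [CompleteSpace H]
  (R : CommIsomRep P H) (μ : Measure G)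

lemma intE_add {f g : G → ℂ} (hf : Integrable f μ) (hg : Integrable g μ)
    (hfg : Integrable (fun x => f x + g x) μ) :
    R.intE μ (fun x => f x + g x) hfg = R.intE μ f hf + R.intE μ g hg := by
  ext ξ
  simp only [add_apply, intE_apply, add_smul]
  exact integral_add (R.integrable_smul_E μ hf ξ) (R.integrable_smul_E μ hg ξ)

lemma norm_intE_le {f : G → ℂ} (hf : Integrable f μ) : ‖R.intE μ f hf‖ ≤ ∫ g, ‖f g‖ ∂μ :=
  LinearMap.mkContinuous_norm_le _ (integral_nonneg fun _ => norm_nonneg _) _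

lemma star_intE {f : G → ℂ} (hf : Integrable f μ) :
    star (R.intE μ f hf) = R.intE μ (fun g => star (f g)) (integrable_star hf) := by
  rw [ContinuousLinearMap.star_eq_adjoint]
  refine (ContinuousLinearMap.eq_adjoint_iff _ _).2 (fun ξ η => ?_) |>.symm
  rw [← inner_conj_symm, intE_apply, intE_apply,
    ← integral_inner (R.integrable_smul_E μ (integrable_star hf) ξ), ← integral_inner
      (R.integrable_smul_E μ hf η), ← integral_conj]
  refine integral_congr_ae (.of_forall fun g => ?_)
  have h : inner ℂ (R.E g ξ) η = inner ℂ ξ (R.E g η) := by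
    rw [← ContinuousLinearMap.adjoint_inner_right, ← ContinuousLinearMap.star_eq_adjoint, star_E]
  simp only [inner_smul_right, RCLike.star_def, map_mul, RCLike.conj_conj, inner_conj_symm, h]

/-- If `E_x T = T` for all `x` in the support of `f`, then `E_f T = (∫ f) T`. -/
lemma intE_mul_of_forall {f : G → ℂ} (hf : Integrable f μ) {X : Set G} (hfX : ∀ x ∉ X, f x = 0)
    {T : H →L[ℂ] H} (hT : ∀ x ∈ X, R.E x * T = T) :
    R.intE μ f hf * T = (∫ g, f g ∂μ) • T := by
  ext ξ
  rw [smul_apply, ← integral_smul_const]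
  change R.intE μ f hf (T ξ) = _
  rw [intE_apply]
  refine integral_congr_ae (.of_forall fun x => ?_)
  by_cases hx : x ∈ X
  · exact congrArg (f x • ·) (congrArg (fun S : H →L[ℂ] H => S ξ) (hT x hx))
  · simp [hfX x hx]

lemma E_mul_intE_of_forall {f : G → ℂ} (hf : Integrable f μ) {Y : Set G}
    (hfY : ∀ y ∉ Y, f y = 0) {x : G} (hx : ∀ y ∈ Y, R.E x * R.E y = R.E y) :
    R.E x * R.intE μ f hf = R.intE μ f hf := by
  ext ξ
  change R.E x (R.intE μ f hf ξ) = _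
  rw [intE_apply, ← ContinuousLinearMap.integral_comp_comm _ (R.integrable_smul_E μ hf ξ)]
  refine integral_congr_ae (.of_forall fun y => ?_)
  by_cases hy : y ∈ Y
  · simp only [map_smul]
    exact congrArg (f y • ·) (congrArg (fun S : H →L[ℂ] H => S ξ) (hx y hy))
  · simp [hfY y hy]

variable {μ} {R}

lemma apply_elemE_of_forall (χ : R.Ω μ) {f : G → ℂ} (hf : Integrable f μ) {X : Set G}
    (hfX : ∀ x ∉ X, f x = 0) {T : R.algA μ} (hT : ∀ x ∈ X, R.E x * (T : H →L[ℂ] H) = T)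
    (hχ : χ T ≠ 0) : χ (R.elemE μ f hf) = ∫ g, f g ∂μ := by
  have h : R.elemE μ f hf * T = (∫ g, f g ∂μ) • T :=
    Subtype.ext (R.intE_mul_of_forall μ hf hfX hT)
  have h1 := congrArg χ h
  rw [map_mul, map_smul, smul_eq_mul] at h1
  exact mul_right_cancel₀ hχ h1

/-- Every E_x with x ∈ X fixes E_{f₂} under left multiplication, so E_{f₁} acts on it as the scalar
∫ f₁; apply χ and cancel its nonzero value. -/
lemma apply_elemE_of_dominating (χ : R.Ω μ) {X Y : Set G}
    (hXY : ∀ x ∈ X, ∀ y ∈ Y, y * x⁻¹ ∈ P)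
    {f₁ f₂ : G → ℂ} (hf₁ : Integrable f₁ μ) (hf₂ : Integrable f₂ μ)
    (hX : ∀ x ∉ X, f₁ x = 0) (hY : ∀ y ∉ Y, f₂ y = 0) (hχ : χ (R.elemE μ f₂ hf₂) ≠ 0) :
    χ (R.elemE μ f₁ hf₁) = ∫ g, f₁ g ∂μ :=
  apply_elemE_of_forall (T := R.elemE μ f₂ hf₂) χ hf₁ hX (fun x hx =>
    R.E_mul_intE_of_forall μ hf₂ hY fun y hy => R.E_mul_E_of_mem (hXY x hx y hy)) hχ

lemma continuous_apply (T : R.algA μ) : Continuous fun χ : R.Ω μ => χ T :=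
  (WeakDual.eval_continuous T).comp continuous_subtype_val

lemma apply_one_ne_zero [μ.IsHaarMeasure] (χ : R.Ω μ) : χ ⟨1, R.one_mem μ⟩ ≠ 0 := by
  intro h1
  refine χ.2.1 (ContinuousLinearMap.ext fun T => ?_)
  change χ T = 0
  have h3 : T = T * ⟨1, R.one_mem μ⟩ := Subtype.ext (mul_one _).symm
  rw [h3, map_mul, h1, mul_zero]

/-- A character is determined by its values on the operators `E_f`. -/
lemma ext_elemE {χ₁ χ₂ : R.Ω μ}
    (h : ∀ f (hf : Integrable f μ), χ₁ (R.elemE μ f hf) = χ₂ (R.elemE μ f hf)) : χ₁ = χ₂ := by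
  -- Preservation of adjoints by characters is not invoked, so the induction also carries agreement
  -- on the adjoint. It starts because the generators are stable under adjoints.
  have key : ∀ T ∈ NonUnitalStarAlgebra.adjoin ℂ
      {T : H →L[ℂ] H | ∃ (f : G → ℂ) (hf : Integrable f μ), T = R.intE μ f hf},
      ∃ hT : T ∈ R.algA μ, χ₁ ⟨T, hT⟩ = χ₂ ⟨T, hT⟩ ∧
        χ₁ (star ⟨T, hT⟩) = χ₂ (star ⟨T, hT⟩) := by
    intro T hT
    induction hT using NonUnitalStarAlgebra.adjoin_induction with
    | mem x hx =>
      obtain ⟨f, hf, rfl⟩ := hx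
      have h1 : star (R.elemE μ f hf) = R.elemE μ _ (integrable_star hf) :=
        Subtype.ext (R.star_intE μ hf)
      refine ⟨R.intE_mem μ hf, h f hf, ?_⟩
      change χ₁ (star (R.elemE μ f hf)) = χ₂ (star (R.elemE μ f hf))
      rw [h1, h]
    | add x y _ _ hx hy =>
      obtain ⟨hx, hx1, hx2⟩ := hx
      obtain ⟨hy, hy1, hy2⟩ := hy
      refine ⟨add_mem hx hy, ?_⟩
      rw [← AddMemClass.mk_add_mk _ _ _ hx hy, star_add, map_add, map_add, map_add, map_add,
        hx1, hx2, hy1, hy2]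
      exact ⟨rfl, rfl⟩
    | zero =>
      refine ⟨zero_mem _, ?_⟩
      change χ₁ 0 = χ₂ 0 ∧ χ₁ (star 0) = χ₂ (star 0)
      simp only [star_zero, map_zero, and_self]
    | mul x y _ _ hx hy =>
      obtain ⟨hx, hx1, hx2⟩ := hx
      obtain ⟨hy, hy1, hy2⟩ := hy
      refine ⟨mul_mem hx hy, ?_⟩
      rw [← MulMemClass.mk_mul_mk _ _ _ hx hy, star_mul, map_mul, map_mul, map_mul, map_mul,
        hx1, hx2, hy1, hy2]
      exact ⟨rfl, rfl⟩
    | smul r x _ hx =>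
      obtain ⟨hx, hx1, hx2⟩ := hx
      refine ⟨SMulMemClass.smul_mem r hx, ?_⟩
      change χ₁ (r • ⟨x, hx⟩) = χ₂ (r • ⟨x, hx⟩) ∧
        χ₁ (star (r • ⟨x, hx⟩)) = χ₂ (star (r • ⟨x, hx⟩))
      rw [star_smul, map_smul, map_smul, map_smul, map_smul, hx1, hx2]
      exact ⟨rfl, rfl⟩
    | star x _ hx =>
      obtain ⟨hx, hx1, hx2⟩ := hx
      refine ⟨star_mem hx, hx2, ?_⟩
      change χ₁ (star (star ⟨x, hx⟩)) = χ₂ (star (star ⟨x, hx⟩))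
      rw [star_star, hx1]
  refine WeakDual.CharacterSpace.ext fun T => ?_
  have hcl : IsClosed {T : R.algA μ | χ₁ T = χ₂ T} :=
    isClosed_eq (map_continuous χ₁) (map_continuous χ₂)
  refine closure_minimal (s := ((↑) : R.algA μ → H →L[ℂ] H) ⁻¹' NonUnitalStarAlgebra.adjoin ℂ
      {T : H →L[ℂ] H | ∃ (f : G → ℂ) (hf : Integrable f μ), T = R.intE μ f hf})
    (fun S hS => (key S hS).2.1) hcl (closure_subtype.2 ?_)
  have hT : (T : H →L[ℂ] H) ∈ closure (NonUnitalStarAlgebra.adjoin ℂ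
      {T : H →L[ℂ] H | ∃ (f : G → ℂ) (hf : Integrable f μ), T = R.intE μ f hf} :
        Set (H →L[ℂ] H)) := T.2
  refine closure_mono ?_ hT
  exact fun S hS => ⟨⟨S, (key S hS).1⟩, hS, rfl⟩

/-! ### The support of a character. -/

section Supp

variable [IsFiniteMeasureOnCompacts μ]

lemma mem_supp_iff {χ : R.Ω μ} {g : G} : g ∈ R.supp μ χ ↔ ∀ U : Set G, IsOpen U → g ∈ U →
    ∃ (f : G → ℂ) (hf : Integrable f μ), Continuous f ∧ HasCompactSupport f ∧ tsupport f ⊆ U ∧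
      χ (R.elemE μ f hf) ≠ 0 := by
  simp only [supp, Set.mem_compl_iff, Set.mem_ofPred_eq, not_exists, not_and, not_forall]
  refine forall_congr' fun U => forall_congr' fun _ => forall_congr' fun _ => ?_
  constructor
  · rintro ⟨f, hc, hs, ht, h⟩
    exact ⟨f, _, hc, hs, ht, h⟩
  · rintro ⟨f, hf, hc, hs, ht, h⟩
    exact ⟨f, hc, hs, ht, h⟩

lemma isClosed_supp (χ : R.Ω μ) : IsClosed (R.supp μ χ) := by
  rw [supp, isClosed_compl_iff, isOpen_iff_forall_mem_open]
  rintro g ⟨U, hU, hg, h⟩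
  exact ⟨U, fun x hx => ⟨U, hU, hx, h⟩, hU, hg⟩

/-- Near points dominating a point of the support, a character is integration. -/
lemma exists_open_apply_elemE_eq_integral {χ : R.Ω μ} {x y : G} (hy : y ∈ R.supp μ χ)
    (hxy : y * x⁻¹ ∈ interior (P : Set G)) :
    ∃ X : Set G, IsOpen X ∧ x ∈ X ∧ ∀ f (hf : Integrable f μ), (∀ g ∉ X, f g = 0) →
      χ (R.elemE μ f hf) = ∫ g, f g ∂μ := by
  obtain ⟨X, Y, hX, hY, hx, hyY, hXY⟩ := ClosedOreSemigroup.exists_open_mul_inv_mem hxy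
  obtain ⟨f₂, hf₂, -, -, ht, h⟩ := mem_supp_iff.1 hy Y hY hyY
  exact ⟨X, hX, hx, fun f hf hfX => apply_elemE_of_dominating χ hXY hf hf₂ hfX
    (fun z hz => image_eq_zero_of_notMem_tsupport fun hzt => hz (ht hzt)) h⟩

variable [μ.IsOpenPosMeasure]

/-- The set X need not contain x. This matters because the identity may lie on the boundary of P, so
only points near x are available strictly below a given point. -/
lemma mem_supp_of_apply_elemE_eq_integral {χ : R.Ω μ} {x : G}
    (h : ∀ U : Set G, IsOpen U → x ∈ U → ∃ X ⊆ U, IsOpen X ∧ X.Nonempty ∧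
      ∀ f (hf : Integrable f μ), (∀ g ∉ X, f g = 0) → χ (R.elemE μ f hf) = ∫ g, f g ∂μ) :
    x ∈ R.supp μ χ := by
  refine mem_supp_iff.2 fun U hU hx => ?_
  obtain ⟨X, hXU, hX, hne, hχ⟩ := h U hU hx
  obtain ⟨f, hc, hs, ht, h0⟩ := exists_continuous_tsupport_subset_integral_ne_zero μ hX hne
  have hf : Integrable f μ := hc.integrable_of_hasCompactSupport hs
  refine ⟨f, hf, hc, hs, ht.trans hXU, ?_⟩
  rw [hχ f hf fun z hz => image_eq_zero_of_notMem_tsupport fun hzt => hz (ht hzt)]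
  exact h0

lemma mem_supp_of_mul_inv_mem {χ : R.Ω μ} {x y : G} (hy : y ∈ R.supp μ χ)
    (hxy : y * x⁻¹ ∈ P) : x ∈ R.supp μ χ := by
  refine mem_supp_of_apply_elemE_eq_integral fun U hU hx => ?_
  have hc : Continuous fun z : G => z⁻¹ * y := by fun_prop
  have h1 : (fun z : G => z⁻¹ * y) ⁻¹' U ∈ 𝓝 (y * x⁻¹) :=
    hc.continuousAt.preimage_mem_nhds (hU.mem_nhds (by simpa using hx))
  -- Replace yx⁻¹ by a nearby s in Int(P): then s⁻¹y is close to x and strictly below y.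
  obtain ⟨s, hsU, hs⟩ := mem_closure_iff_nhds.1
    (ClosedOreSemigroup.subset_closure_interior (P := P) hxy) _ h1
  obtain ⟨X, hX, hsX, h⟩ := exists_open_apply_elemE_eq_integral (x := s⁻¹ * y) hy
    (by simpa using hs)
  exact ⟨X ∩ U, Set.inter_subset_right, hX.inter hU, ⟨_, hsX, hsU⟩,
    fun f hf hfX => h f hf fun g hg => hfX g fun hg' => hg hg'.1⟩

/-- Near points outside the support, a character vanishes on all integrable functions. -/
lemma exists_open_apply_elemE_eq_zero {χ : R.Ω μ} {y : G} (hy : y ∉ R.supp μ χ) :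
    ∃ Y : Set G, IsOpen Y ∧ y ∈ Y ∧ ∀ f (hf : Integrable f μ), (∀ g ∉ Y, f g = 0) →
      χ (R.elemE μ f hf) = 0 := by
  rw [supp, Set.notMem_compl_iff] at hy
  obtain ⟨U, hU, hyU, hχ⟩ := hy
  obtain ⟨X, Y, hX, hXne, hXU, hY, hyY, hXY⟩ := ClosedOreSemigroup.exists_open_dominating P hU hyU
  obtain ⟨f₁, hc, hs, ht, h0⟩ := exists_continuous_tsupport_subset_integral_ne_zero μ hX hXne
  refine ⟨Y, hY, hyY, fun f hf hfY => ?_⟩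
  -- A nonzero value on f would force χ(E_{f₁}) = ∫ f₁ ≠ 0, although f₁ is supported in U, where χ
  -- kills test functions.
  by_contra hne
  have h := apply_elemE_of_dominating χ hXY (hc.integrable_of_hasCompactSupport hs) hf
    (fun z hz => image_eq_zero_of_notMem_tsupport fun hzt => hz (ht hzt)) hfY hne
  rw [hχ f₁ hc hs (ht.trans hXU)] at h
  exact h0 h.symm

end Supp

/-! ### The integral formula. -/

section Haar

variable [μ.IsHaarMeasure]

lemma inv_mul_mem_supp (χ : R.Ω μ) {a x : G} (ha : a ∈ P) (hx : x ∈ R.supp μ χ) :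
    a⁻¹ * x ∈ R.supp μ χ :=
  mem_supp_of_mul_inv_mem hx (by simpa using ha)

/-- On P⁻¹ the projections E_x are the identity, so there χ is integration; and Int(P)⁻¹ accumulates
at the identity. -/
lemma one_mem_supp (χ : R.Ω μ) : (1 : G) ∈ R.supp μ χ := by
  refine mem_supp_of_apply_elemE_eq_integral fun U hU h1 => ?_
  obtain ⟨s, hs, hsU⟩ := ClosedOreSemigroup.exists_mem_interior_inv_mul (P := P) hU h1
  refine ⟨(interior (P : Set G))⁻¹ ∩ U, Set.inter_subset_right, isOpen_interior.inv.inter hU,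
    ⟨s⁻¹, Set.inv_mem_inv.2 hs, by simpa using hsU⟩, fun f hf hfX => ?_⟩
  refine apply_elemE_of_forall χ hf hfX (fun x hx => ?_) (apply_one_ne_zero χ)
  have h := R.E_inv ⟨x⁻¹, interior_subset hx.1⟩
  simp only [inv_inv] at h
  rw [h, one_mul]

lemma inv_mem_supp (χ : R.Ω μ) {a : G} (ha : a ∈ P) : a⁻¹ ∈ R.supp μ χ := by
  simpa using inv_mul_mem_supp χ ha (one_mem_supp χ)

theorem apply_elemE_eq_integral_indicator [T2Space G] (χ : R.Ω μ) (f : G → ℂ)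
    (hf : Integrable f μ) :
    χ (R.elemE μ f hf) = ∫ g, (R.supp μ χ).indicator f g ∂μ := by
  set A := R.supp μ χ with hAdef
  have hA : IsClosed A := isClosed_supp χ
  rw [← sub_eq_zero]
  refine eq_zero_of_locally_eq_zero
    (D := fun f hf => χ (R.elemE μ f hf) - ∫ g, A.indicator f g ∂μ)
    (‖WeakDual.CharacterSpace.toCLM χ‖ + 1) ?_ ?_
    (ClosedOreSemigroup.measure_diff_interior (P := P) μ hA
      fun a ha x hx => inv_mul_mem_supp χ ha hx) ?_ f hf
  · intro f g hf hg hfg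
    have h1 : R.elemE μ (fun x => f x + g x) hfg = R.elemE μ f hf + R.elemE μ g hg :=
      Subtype.ext (R.intE_add μ hf hg hfg)
    have h2 : ∫ x, A.indicator (fun x => f x + g x) x ∂μ =
        ∫ x, A.indicator f x ∂μ + ∫ x, A.indicator g x ∂μ := by
      rw [← integral_add (hf.indicator hA.measurableSet) (hg.indicator hA.measurableSet),
        Set.indicator_add]
    rw [h1, map_add, h2]
    ring
  · intro f hf
    have h1 : ‖χ (R.elemE μ f hf)‖ ≤ ‖WeakDual.CharacterSpace.toCLM χ‖ * ∫ g, ‖f g‖ ∂μ :=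
      ((WeakDual.CharacterSpace.toCLM χ).le_opNorm (R.elemE μ f hf)).trans
        (mul_le_mul_of_nonneg_left (R.norm_intE_le μ hf) (norm_nonneg _))
    have h2 : ‖∫ g, A.indicator f g ∂μ‖ ≤ ∫ g, ‖f g‖ ∂μ :=
      norm_integral_le_of_norm_le hf.norm (.of_forall fun g => norm_indicator_le_norm_self _ _)
    rw [add_mul, one_mul]
    exact (norm_sub_le _ _).trans (add_le_add h1 h2)
  · intro x hx
    by_cases hxA : x ∈ A
    · have hxi : x ∈ interior A := by
        by_contra h
        exact hx ⟨hxA, h⟩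
      -- Moving x up by a small s ∈ Int(P) stays inside A, which makes x strictly below a point of
      -- the support.
      obtain ⟨s, hs, hsA⟩ :=
        ClosedOreSemigroup.exists_mem_interior_mul (P := P) isOpen_interior hxi
      obtain ⟨X, hX, hxX, h⟩ := exists_open_apply_elemE_eq_integral (χ := χ) (x := x)
        (interior_subset hsA) (by simpa using hs)
      refine ⟨X ∩ interior A, hX.inter isOpen_interior, ⟨hxX, hxi⟩, fun f hf hfX => ?_⟩
      rw [h f hf fun g hg => hfX g fun hg' => hg hg'.1,
        Set.indicator_eq_self.2 fun g hg => ?_, sub_self]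
      by_contra hgA
      exact hg (hfX g fun hg' => hgA (interior_subset hg'.2))
    · obtain ⟨Y, hY, hxY, h⟩ := exists_open_apply_elemE_eq_zero hxA
      refine ⟨Y ∩ Aᶜ, hY.inter hA.isOpen_compl, ⟨hxY, hxA⟩, fun f hf hfY => ?_⟩
      have h0 : A.indicator f = 0 := Set.indicator_eq_zero.2
        (Set.disjoint_left.2 fun g hg hgA => hg (hfY g fun hg' => hg'.2 hgA))
      rw [h f hf fun g hg => hfY g fun hg' => hg hg'.1, h0]
      simp

end Haar

end Character

/-! ### Equivariance of the support. -/

section Action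

variable {G : Type*} [Group G] [TopologicalSpace G] [IsTopologicalGroup G]
  [LocallyCompactSpace G] [SecondCountableTopology G] [MeasurableSpace G] [BorelSpace G]
  {P : Submonoid G} [ClosedOreSemigroup P]
  {H : Type*} [NormedAddCommGroup H] [InnerProductSpace ℂ H] [CompleteSpace H]
  (R : CommIsomRep P H) (μ : Measure G) [μ.IsHaarMeasure]

/-- `α_a(E_f)` is a nonzero multiple of the operator of the right translate of `f`. -/
lemma exists_conj_intE_eq_smul (a : P) : ∃ c : ℂ, c ≠ 0 ∧ ∀ (f : G → ℂ) (hf : Integrable f μ),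
    ∃ hf' : Integrable (fun g => f (g * a)) μ,
      R.conj a (R.intE μ f hf) = c • R.intE μ (fun g => f (g * a)) hf' := by
  have hmeas : Measurable fun g : G => g * (a : G)⁻¹ := measurable_mul_const _
  set ν : Measure G := μ.map fun g => g * (a : G)⁻¹ with hν
  -- A right translate of Haar measure is still left invariant, so uniqueness gives the modular
  -- factor c. Only c ≠ 0 is used later, as the support depends just on which values vanish.
  obtain ⟨c, hc⟩ : ∃ c : NNReal, ν = c • μ := ⟨_, Measure.isMulLeftInvariant_eq_smul ν μ⟩
  have hc0 : c ≠ 0 := by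
    rintro rfl
    rw [zero_smul, hν, Measure.map_eq_zero_iff hmeas.aemeasurable] at hc
    exact NeZero.ne μ hc
  refine ⟨c, by exact_mod_cast hc0, fun f hf => ?_⟩
  have hfν : Integrable (fun g => f (g * a)) ν :=
    (integrable_map_equiv (μ := μ) (MeasurableEquiv.mulRight (a : G)⁻¹)
      fun g => f (g * a)).2 (by simpa [Function.comp_def] using hf)
  have hf' : Integrable (fun g => f (g * a)) μ := by
    rw [hc] at hfν
    exact (integrable_smul_measure (c := (c : ENNReal)) (by simpa using hc0)
      ENNReal.coe_ne_top).1 hfν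
  refine ⟨hf', ?_⟩
  ext ξ
  have h1 : R.conj a (R.intE μ f hf) ξ = ((R.V a)†) (R.intE μ f hf (R.V a ξ)) := rfl
  have h2 : ∀ g, ((R.V a)†) (f g • R.E g (R.V a ξ)) = f g • R.E (g * (a : G)⁻¹) ξ := by
    intro g
    rw [← V_conj_E, map_smul]; rfl
  rw [smul_apply, h1, intE_apply, intE_apply,
    ← ContinuousLinearMap.integral_comp_comm _ (R.integrable_smul_E μ hf _)]
  simp only [h2]
  calc ∫ g, f g • R.E (g * (a : G)⁻¹) ξ ∂μ = ∫ g, f (g * a) • R.E g ξ ∂ν := by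
        refine Eq.trans ?_ (integral_map_equiv (μ := μ) (MeasurableEquiv.mulRight (a : G)⁻¹)
          fun g => f (g * a) • R.E g ξ).symm
        simp
    _ = (c : ℂ) • ∫ g, f (g * a) • R.E g ξ ∂μ := by
        rw [hc, integral_smul_nnreal_measure]
        rfl

variable {R μ}

lemma act_apply_elemE_eq_zero_iff (χ : R.Ω μ) (a : P) {f : G → ℂ} (hf : Integrable f μ)
    (hf' : Integrable (fun g => f (g * a)) μ) :
    R.act μ χ a (R.elemE μ f hf) = 0 ↔ χ (R.elemE μ (fun g => f (g * a)) hf') = 0 := by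
  obtain ⟨c, hc, h⟩ := R.exists_conj_intE_eq_smul μ a
  obtain ⟨_, h1⟩ := h f hf
  have h2 : R.alpha μ a (R.elemE μ f hf) = c • R.elemE μ (fun g => f (g * a)) hf' :=
    Subtype.ext h1
  rw [act_apply, h2, map_smul, smul_eq_zero_iff_right hc]

lemma supp_act (χ : R.Ω μ) (a : P) :
    R.supp μ (R.act μ χ a) = (fun x => x * (a : G)) '' R.supp μ χ := by
  have htrans : ∀ (b : G) (f : G → ℂ), Continuous f → HasCompactSupport f →
      Continuous (fun g => f (g * b)) ∧ HasCompactSupport (fun g => f (g * b)) ∧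
        tsupport (fun g => f (g * b)) ⊆ (fun g => g * b) ⁻¹' tsupport f := fun b f hc hs =>
    ⟨hc.comp (continuous_mul_const b), hs.comp_homeomorph (Homeomorph.mulRight b),
      tsupport_comp_subset_preimage f (continuous_mul_const b)⟩
  ext g
  rw [Set.image_mul_right, Set.mem_preimage, mem_supp_iff, mem_supp_iff]
  constructor
  · intro h U hU hg
    obtain ⟨f, hf, hc, hs, ht, h0⟩ := h _ (hU.preimage (continuous_mul_const (a : G)⁻¹)) hg
    obtain ⟨hc', hs', ht'⟩ := htrans a f hc hs
    have hf' := hc'.integrable_of_hasCompactSupport (μ := μ) hs'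
    refine ⟨_, hf', hc', hs', fun x hx => ?_, mt (act_apply_elemE_eq_zero_iff χ a hf hf').2 h0⟩
    simpa using ht (ht' hx)
  · intro h U hU hg
    obtain ⟨f, hf, hc, hs, ht, h0⟩ := h _ (hU.preimage (continuous_mul_const (a : G)))
      (by simpa using hg)
    -- Translate by a⁻¹, so that the translation by a coming from the action restores f.
    obtain ⟨hc', hs', ht'⟩ := htrans (a : G)⁻¹ f hc hs
    have hf' := hc'.integrable_of_hasCompactSupport (μ := μ) hs'
    refine ⟨_, hf', hc', hs', fun x hx => ?_, ?_⟩
    · simpa using ht (ht' hx)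
    · have hfa : Integrable (fun g => f (g * (a : G) * (a : G)⁻¹)) μ := by simpa using hf
      refine mt (act_apply_elemE_eq_zero_iff χ a hf' hfa).1 ?_
      simpa using h0

end Action

/-! ### Injectivity and continuity of the support map. -/

section SupportMap

variable {G : Type*} [Group G] [TopologicalSpace G] [IsTopologicalGroup G]
  [LocallyCompactSpace G] [SecondCountableTopology G] [MeasurableSpace G]
  [BorelSpace G] {P : Submonoid G} [ClosedOreSemigroup P]
  {H : Type*} [NormedAddCommGroup H] [InnerProductSpace ℂ H] [CompleteSpace H]
  (R : CommIsomRep P H) (μ : Measure G) [μ.IsHaarMeasure]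

/-- The support map `χ ↦ A_χ` from `Ω` to `Ω_u`. -/
def supportMap (χ : R.Ω μ) : OmegaU P where
  carrier := ⟨R.supp μ χ, isClosed_supp χ⟩
  inv_mem _ ha := inv_mem_supp χ ha
  inv_mul_mem _ ha _ hx := inv_mul_mem_supp χ ha hx

lemma supportMap_act (χ : R.Ω μ) (a : P) :
    R.supportMap μ (R.act μ χ a) = (R.supportMap μ χ).act a := by
  have h : (R.supportMap μ (R.act μ χ a)).carrier = ((R.supportMap μ χ).act a).carrier :=
    TopologicalSpace.Closeds.ext (supp_act χ a)
  revert h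
  generalize R.supportMap μ (R.act μ χ a) = A
  generalize (R.supportMap μ χ).act a = B
  intro h
  cases A
  cases B
  congr

variable [T2Space G]

lemma supportMap_injective : Function.Injective (R.supportMap μ) := by
  intro χ₁ χ₂ h
  have hs : R.supp μ χ₁ = R.supp μ χ₂ :=
    congrArg (fun A : OmegaU P => (A.carrier : Set G)) h
  refine ext_elemE fun f hf => ?_
  rw [apply_elemE_eq_integral_indicator, apply_elemE_eq_integral_indicator, hs]

/-- A single f supported in U with χ(E_f) ≠ 0 suffices: this persists for nearby characters, and the
integral formula then makes their supports meet U. -/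
lemma isOpen_setOf_supp_inter_nonempty {U : Set G} (hU : IsOpen U) :
    IsOpen {χ : R.Ω μ | (R.supp μ χ ∩ U).Nonempty} := by
  rw [isOpen_iff_mem_nhds]
  rintro χ ⟨g, hg, hgU⟩
  obtain ⟨f, hf, -, -, ht, h0⟩ := mem_supp_iff.1 hg U hU hgU
  have h1 : {χ' : R.Ω μ | χ' (R.elemE μ f hf) ≠ 0} ∈ 𝓝 χ :=
    (isOpen_ne_fun (continuous_apply _) continuous_const).mem_nhds h0
  filter_upwards [h1] with χ' hχ'
  by_contra hne
  refine hχ' ?_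
  rw [apply_elemE_eq_integral_indicator, Set.indicator_eq_zero.2 (Set.disjoint_left.2 ?_)]
  · simp
  · exact fun x hx hxA => hne ⟨x, hxA, ht (subset_tsupport f hx)⟩

/-- For x ∈ K choose f living off the support, at points below a whole neighbourhood Y of x. If the
support of χ' meets Y it contains the support of f, forcing χ'(E_f) = ∫ f; this fails near χ, where
the value is 0. Compactness of K makes the neighbourhood of χ uniform. -/
lemma isOpen_setOf_supp_inter_eq_empty {K : Set G} (hK : IsCompact K) :
    IsOpen {χ : R.Ω μ | R.supp μ χ ∩ K = ∅} := by
  rw [isOpen_iff_mem_nhds]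
  intro χ hχ
  have key : ∀ᶠ χ' in 𝓝 χ, ∀ x ∈ K, x ∉ R.supp μ χ' := by
    refine hK.eventually_forall_of_forall_eventually fun x hx => ?_
    have hxA : x ∈ (R.supp μ χ)ᶜ := fun h =>
      Set.notMem_empty x (Set.mem_ofPred_eq ▸ hχ ▸ ⟨h, hx⟩)
    have hAo : IsOpen (R.supp μ χ)ᶜ := (isClosed_supp χ).isOpen_compl
    obtain ⟨X, Y, hX, hXne, hXA, hY, hxY, hXY⟩ :=
      ClosedOreSemigroup.exists_open_dominating P hAo hxA
    obtain ⟨f, hc, hs, ht, h0⟩ := exists_continuous_tsupport_subset_integral_ne_zero μ hX hXne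
    have hf : Integrable f μ := hc.integrable_of_hasCompactSupport hs
    have hχf : χ (R.elemE μ f hf) ≠ ∫ g, f g ∂μ := by
      rw [apply_elemE_eq_integral_indicator, Set.indicator_eq_zero.2 (Set.disjoint_left.2 ?_)]
      · simpa using h0.symm
      · exact fun z hz => hXA (ht (subset_tsupport f hz))
    have h1 : {χ' : R.Ω μ | χ' (R.elemE μ f hf) ≠ ∫ g, f g ∂μ} ∈ 𝓝 χ :=
      (isOpen_ne_fun (continuous_apply _) continuous_const).mem_nhds hχf
    refine Filter.mem_of_superset (prod_mem_nhds h1 (hY.mem_nhds hxY)) ?_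
    rintro ⟨χ', y⟩ ⟨hχ', hy⟩ hyA
    refine hχ' ?_
    have hsub : Function.support f ⊆ R.supp μ χ' := fun z hz =>
      mem_supp_of_mul_inv_mem hyA (hXY z (ht (subset_tsupport f hz)) y hy)
    rw [apply_elemE_eq_integral_indicator, Set.indicator_eq_self.2 hsub]
  filter_upwards [key] with χ' hχ'
  exact Set.eq_empty_iff_forall_notMem.2 fun x hx => hχ' x hx.2 hx.1

lemma continuous_supportMap : Continuous (R.supportMap μ) := by
  refine continuous_induced_rng.2 (continuous_generateFrom_iff.2 ?_)
  rintro s (⟨U, hU, rfl⟩ | ⟨K, hK, rfl⟩)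
  · exact R.isOpen_setOf_supp_inter_nonempty μ hU
  · exact R.isOpen_setOf_supp_inter_eq_empty μ hK

lemma act_injective (a : P) : Function.Injective fun χ : R.Ω μ => R.act μ χ a := by
  intro χ₁ χ₂ h
  have h1 : R.supp μ (R.act μ χ₁ a) = R.supp μ (R.act μ χ₂ a) := congrArg (R.supp μ) h
  rw [supp_act, supp_act] at h1
  have h2 := (mul_left_injective (a : G)).image_injective h1
  refine ext_elemE fun f hf => ?_
  rw [apply_elemE_eq_integral_indicator, apply_elemE_eq_integral_indicator, h2]

end SupportMap

end CommIsomRep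

theorem proposition4p7 {G : Type*} [Group G] [TopologicalSpace G] [IsTopologicalGroup G]
    [LocallyCompactSpace G] [SecondCountableTopology G] [T2Space G]
    [MeasurableSpace G] [BorelSpace G] (μ : Measure G) [μ.IsHaarMeasure]
    (P : Submonoid G) [ClosedOreSemigroup P]
    {H : Type*} [NormedAddCommGroup H] [InnerProductSpace ℂ H] [CompleteSpace H]
    (R : CommIsomRep P H) :
    (∃ Φ : R.Ω μ → OmegaU P,
      (∀ χ, ((Φ χ).carrier : Set G) = R.supp μ χ) ∧
      Function.Injective Φ ∧
      Continuous Φ ∧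
      ∀ (χ : R.Ω μ) (a : P), Φ (R.act μ χ a) = (Φ χ).act a) ∧
    (∀ a : P, Function.Injective fun χ : R.Ω μ => R.act μ χ a) ∧
    ∀ (χ : R.Ω μ) (f : G → ℂ) (hf : Integrable f μ),
      χ (R.elemE μ f hf) = ∫ g, (R.supp μ χ).indicator f g ∂μ :=
  ⟨⟨R.supportMap μ, fun _ => rfl, R.supportMap_injective μ, R.continuous_supportMap μ,
    R.supportMap_act μ⟩, R.act_injective μ, CommIsomRep.apply_elemE_eq_integral_indicator⟩
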